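/- Let $G$ be a group and let $\mathcal F=(F_i)_{i\in I}$ be a right Følner net for $G$, i.e. a family, indexed by a directed set $I$, of non-empty finite subsets of $G$ with $\lim_i |F_i\setminus F_ig|/|F_i|=0$ for every $g\in G$ (so that $G$ is amenable). Let $K$ be an algebraically closed field, let $X$ be an algebraic variety over $K$, i.e. a scheme of finite type over $K$, and let $A:=X(K)$. For a finite set $\Omega$, let $X^\Omega$ be the $K$-fibered product of copies of $X$ indexed by $\Omega$; then $A^\Omega=X^\Omega(K)$ is identified with the set of closed points of $X^\Omega$, and its subsets carry the topology induced by the Zariski topology of $X^\Omega$; $\dim$ denotes Krull dimension. Let $\tau\colon A^G\to A^G$ be an algebraic cellular automaton over $(G,X,K)$: there are a finite subset $M\subset G$ and a $K$-scheme morphism $f\colon X^M\to X$, inducing the map $f^{(K)}\colon A^M\to A$ on $K$-points, such that $\tau(c)(g)=f^{(K)}((g^{-1}c)|_M)$ for all $c\in A^G$ and $g\in G$, where $(gc)(h)=c(g^{-1}h)$. For a finite $\Omega\subset G$, $D\subset A^\Omega$ and $p\in A^{G\setminus\Omega}$, let $D_p:=\{c\in A^G: c|_\Omega\in D,\ c|_{G\setminus\Omega}=p\}$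 and $\dim(D_p):=\dim(D)$. This does not depend on the representation $D_p$ of the set, and $\tau(D_p)$ is again a set of this form. Suppose that $\tau$ is $(**)$-pre-injective: there is no finite subset $\Omega\subset G$ such that $\dim(\tau((A^\Omega)_p))<\dim(A^\Omega)$ for all $p\in A^{G\setminus\Omega}$. Then $$\operatorname{mdim}_{\mathcal F}(\tau(A^G))=\dim(X),$$ where, for $\Gamma\subset A^G$ with restrictions $\Gamma_{F_i}:=\{c|_{F_i}:c\in\Gamma\}\subset A^{F_i}$, the algebraic mean dimension is $\operatorname{mdim}_{\mathcal F}(\Gamma):=\limsup_{i\in I}\dim(\Gamma_{F_i})/|F_i|$. -/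

import Mathlib

open CategoryTheory CategoryTheory.Limits AlgebraicGeometry Filter Topology

universe u v w

noncomputable section

namespace AlgCA

section Varieties

variable {K : Type u} [Field K]

/-- The set `X(K)` of `K`-points of a `K`-scheme `X`: the `K`-scheme morphisms `Spec K ⟶ X`. -/
abbrev Pts (X : Over (Spec (.of K))) : Type u :=
  Over.mk (𝟙 (Spec (.of K))) ⟶ X

/-- The `K`-fibered product `X^E` of a finite family of copies of `X`
(a product in the category of `K`-schemes). -/
abbrev Pow (X : Over (Spec (.of K))) (E : Type v) [Finite E] : Over (Spec (.of K)) :=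
  ∏ᶜ fun _ : E => X

/-- The identification `X(K)^E = X^E(K)`. -/
def powPt (X : Over (Spec (.of K))) {E : Type v} [Finite E] (a : E → Pts X) : Pts (Pow X E) :=
  Pi.lift a

/-- The map induced on `K`-points by a `K`-scheme morphism `f : X^E ⟶ X`. -/
def inducedMap (X : Over (Spec (.of K))) {E : Type v} [Finite E] (f : Pow X E ⟶ X) :
    (E → Pts X) → Pts X :=
  fun a => powPt X a ≫ f

/-- The point of the underlying space of `Y` that is the image, under a `K`-point of `Y`, of the
unique point of `Spec K`. -/
def underlyingPt {Y : Over (Spec (.of K))} (y : Pts Y) : Y.left :=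
  y.left (IsLocalRing.closedPoint K : PrimeSpectrum K)

/-- A set `D` of elements of `X(K)^E`, viewed as a set of points of the scheme `X^E`. -/
def zariskiSet (X : Over (Spec (.of K))) {E : Type v} [Finite E] (D : Set (E → Pts X)) :
    Set (Pow X E).left :=
  (fun a => underlyingPt (powPt X a)) '' D

/-- The Krull dimension of `D ⊆ X(K)^E` for the topology induced by the Zariski topology
of `X^E`. The empty set has dimension `⊥`. -/
def dimZ (X : Over (Spec (.of K))) {E : Type v} [Finite E] (D : Set (E → Pts X)) : WithBot ℕ∞ :=
  topologicalKrullDim (zariskiSet X D)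

end Varieties

section Configurations

variable {G : Type v} {A : Type u}

/-- The `G`-shift on configurations, `(gc)(h) = c(g⁻¹h)`. -/
def shift [Group G] (g : G) (c : G → A) : G → A := fun h => c (g⁻¹ * h)

/-- The restriction of a configuration to a finite set. -/
def res (Ω : Finset G) (c : G → A) : Ω → A := fun g => c g

/-- `μ : A^M → A` is a local defining map of `τ` for the memory set `M`. -/
def IsLocalDefiningMap [Group G] (τ : (G → A) → (G → A)) (M : Finset G) (μ : (M → A) → A) : Prop :=
  ∀ (c : G → A) (g : G), τ c g = μ (res M (shift g⁻¹ c))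

/-- The set `D_p` of all configurations whose restriction to `Ω` lies in `D` and whose restriction
to the complement of `Ω` is `p`. -/
def cyl (Ω : Finset G) (D : Set (Ω → A)) (p : {g : G // g ∉ Ω} → A) : Set (G → A) :=
  {c | res Ω c ∈ D ∧ ∀ g : {g : G // g ∉ Ω}, c g = p g}

/-- A Følner net: non-empty finite sets `F i` with `|F i \ (F i) g| / |F i| → 0` for every `g`. -/
structure IsFolnerNet [Group G] {I : Type w} [Preorder I] (F : I → Finset G) : Prop where
  nonempty : ∀ i, (F i).Nonempty
  tendsto : ∀ g : G, Tendsto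
    (fun i => (((F i : Set G) \ ((fun h => h * g) '' (F i : Set G))).ncard : ℝ) / ((F i).card : ℝ))
    atTop (𝓝 0)

end Configurations

section Algebraic

variable {K : Type u} [Field K] {G : Type v}

/-- `τ` is an algebraic cellular automaton over `(G, X, K)`: it has a memory set `M` whose local
defining map is induced by a `K`-scheme morphism `X^M ⟶ X`. -/
def IsAlgebraicCA [Group G] (X : Over (Spec (.of K))) (τ : (G → Pts X) → (G → Pts X)) : Prop :=
  ∃ (M : Finset G) (f : Pow X M ⟶ X), IsLocalDefiningMap τ M (inducedMap X f)

/-- The configuration equal to `a` on `Ω` and to `p` outside `Ω`. -/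
def glue {A : Type u} (Ω : Finset G) (a : Ω → A) (p : {g : G // g ∉ Ω} → A) : G → A :=
  open Classical in fun g => if h : g ∈ Ω then a ⟨g, h⟩ else p ⟨g, h⟩

theorem res_glue {A : Type u} (Ω : Finset G) (a : Ω → A) (p : {g : G // g ∉ Ω} → A) :
    res Ω (glue Ω a p) = a := by
  funext g
  simp [res, glue]

theorem glue_mem_cyl {A : Type u} {Ω : Finset G} {D : Set (Ω → A)} {a : Ω → A} (ha : a ∈ D)
    (p : {g : G // g ∉ Ω} → A) : glue Ω a p ∈ cyl Ω D p :=
  ⟨by rwa [res_glue], fun g => by simp [glue, g.2]⟩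

theorem glue_res {A : Type u} {Ω : Finset G} {D : Set (Ω → A)} {p : {g : G // g ∉ Ω} → A}
    {c : G → A} (hc : c ∈ cyl Ω D p) : glue Ω (res Ω c) p = c := by
  funext g
  by_cases h : g ∈ Ω
  · simp [glue, res, h]
  · simp [glue, h, hc.2 ⟨g, h⟩]

/-- The morphism `X^Ω ⟶ X^Λ` that induces `a ↦ (glue Ω a p)|_Λ` on `K`-points. -/
def glueHom (X : Over (Spec (.of K))) (Ω Λ : Finset G) (p : {g : G // g ∉ Ω} → Pts X) :
    Pow X Ω ⟶ Pow X Λ :=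
  open Classical in Pi.lift fun l : Λ =>
    if h : (l : G) ∈ Ω then Pi.π (fun _ : Ω => X) ⟨l, h⟩
    else Over.mkIdTerminal.from (Pow X Ω) ≫ p ⟨l, h⟩

theorem powPt_glueHom (X : Over (Spec (.of K))) (Ω Λ : Finset G) (p : {g : G // g ∉ Ω} → Pts X)
    (a : Ω → Pts X) : powPt X a ≫ glueHom X Ω Λ p = powPt X (res Λ (glue Ω a p)) := by
  refine Pi.hom_ext _ _ fun l => ?_
  by_cases h : (l : G) ∈ Ω
  · simp [powPt, glueHom, res, glue, h]
  · have h1 : ∀ t : Over.mk (𝟙 (Spec (.of K))) ⟶ Over.mk (𝟙 (Spec (.of K))), t = 𝟙 _ :=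
      fun t => Over.mkIdTerminal.hom_ext _ _
    simp only [powPt, glueHom, res, glue, h, Category.assoc, Pi.lift_π, dif_neg, not_false_eq_true]
    rw [← Category.assoc, h1 (_ ≫ _), Category.id_comp]

theorem glueHom_underlyingPt (X : Over (Spec (.of K))) (Ω Λ : Finset G)
    (p : {g : G // g ∉ Ω} → Pts X) (a : Ω → Pts X) :
    (glueHom X Ω Λ p).left (underlyingPt (powPt X a)) =
      underlyingPt (powPt X (res Λ (glue Ω a p))) := by
  rw [← powPt_glueHom]
  simp [underlyingPt]
  rfl

theorem mapsTo_glueHom (X : Over (Spec (.of K))) {Ω Λ : Finset G} {D : Set (Ω → Pts X)}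
    {E : Set (Λ → Pts X)} {p : {g : G // g ∉ Ω} → Pts X} {q : {g : G // g ∉ Λ} → Pts X}
    (h : cyl Ω D p = cyl Λ E q) :
    Set.MapsTo (glueHom X Ω Λ p).left (zariskiSet X D) (zariskiSet X E) := by
  rintro _ ⟨a, ha, rfl⟩
  have hc := glue_mem_cyl ha p
  rw [h] at hc
  exact ⟨_, hc.1, (glueHom_underlyingPt X Ω Λ p a).symm⟩

theorem leftInvOn_glueHom (X : Over (Spec (.of K))) {Ω Λ : Finset G} {D : Set (Ω → Pts X)}
    {E : Set (Λ → Pts X)} {p : {g : G // g ∉ Ω} → Pts X} {q : {g : G // g ∉ Λ} → Pts X}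
    (h : cyl Ω D p = cyl Λ E q) {x : (Pow X Ω).left} (hx : x ∈ zariskiSet X D) :
    (glueHom X Λ Ω q).left ((glueHom X Ω Λ p).left x) = x := by
  obtain ⟨a, ha, rfl⟩ := hx
  have hc := glue_mem_cyl ha p
  rw [h] at hc
  rw [glueHom_underlyingPt, glueHom_underlyingPt, glue_res hc, res_glue]

theorem dimZ_eq_of_cyl_eq (X : Over (Spec (.of K))) {Ω Λ : Finset G} {D : Set (Ω → Pts X)}
    {E : Set (Λ → Pts X)} {p : {g : G // g ∉ Ω} → Pts X} {q : {g : G // g ∉ Λ} → Pts X}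
    (h : cyl Ω D p = cyl Λ E q) : dimZ X D = dimZ X E := by
  let e : zariskiSet X D ≃ₜ zariskiSet X E :=
    { toFun := (mapsTo_glueHom X h).restrict
      invFun := (mapsTo_glueHom X h.symm).restrict
      left_inv := fun x => Subtype.ext (leftInvOn_glueHom X h x.2)
      right_inv := fun x => Subtype.ext (leftInvOn_glueHom X h.symm x.2)
      continuous_toFun := (glueHom X Ω Λ p).left.continuous.restrict (mapsTo_glueHom X h)
      continuous_invFun := (glueHom X Λ Ω q).left.continuous.restrict (mapsTo_glueHom X h.symm) }
  exact IsHomeomorph.topologicalKrullDim_eq e e.isHomeomorph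

/-- The dimension of a set of configurations with finite support: `dim (D_p) = dim D`.
The value does not depend on the way in which the set is written as `D_p`
(see `finSuppDim_cyl`), so that the infimum is one over equal values. -/
def finSuppDim (X : Over (Spec (.of K))) (Γ : Set (G → Pts X)) : WithBot ℕ∞ :=
  sInf {d | ∃ (Ω : Finset G) (D : Set (Ω → Pts X)) (p : {g : G // g ∉ Ω} → Pts X),
    Γ = cyl Ω D p ∧ d = dimZ X D}

theorem finSuppDim_cyl (X : Over (Spec (.of K))) (Ω : Finset G) (D : Set (Ω → Pts X))
    (p : {g : G // g ∉ Ω} → Pts X) : finSuppDim X (cyl Ω D p) = dimZ X D := by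
  have h : {d | ∃ (Λ : Finset G) (E : Set (Λ → Pts X)) (q : {g : G // g ∉ Λ} → Pts X),
      cyl Ω D p = cyl Λ E q ∧ d = dimZ X E} = {dimZ X D} := by
    ext d
    constructor
    · rintro ⟨Λ, E, q, h, rfl⟩
      exact (dimZ_eq_of_cyl_eq X h).symm
    · rintro rfl
      exact ⟨Ω, D, p, rfl, rfl⟩
  rw [finSuppDim, h, sInf_singleton]

/-- `(**)`-pre-injectivity: there is no finite `Ω ⊆ G` such that
`dim τ((A^Ω)_p) < dim A^Ω` for all `p ∈ A^{G ∖ Ω}`. -/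
def IsStarStarPreInjective (X : Over (Spec (.of K))) (τ : (G → Pts X) → (G → Pts X)) : Prop :=
  ¬ ∃ Ω : Finset G, ∀ p : {g : G // g ∉ Ω} → Pts X,
    finSuppDim X (τ '' cyl Ω Set.univ p) < dimZ X (Set.univ : Set (Ω → Pts X))

/-- A dimension, regarded as an extended real number; `dim ∅ = -∞`. -/
def dimToEReal : WithBot ℕ∞ → EReal
  | ⊥ => ⊥
  | (n : ℕ∞) => ((n : ENNReal) : EReal)

/-- The algebraic mean dimension `limsup_i dim(Γ_{F i}) / |F i|`. -/
def mdim (X : Over (Spec (.of K))) {I : Type w} [Preorder I] (F : I → Finset G)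
    (Γ : Set (G → Pts X)) : EReal :=
  limsup (fun i => dimToEReal (dimZ X (res (F i) '' Γ)) / (((F i).card : ℝ) : EReal)) atTop

end Algebraic

end AlgCA

end

/-! All dimensions are read off from transcendence degrees of residue fields. For a morphism `φ : Y
⟶ Z` of schemes of finite type over K, the set of images of K-points has dimension equal to the
maximum over `y` of the transcendence degree of the residue field at `φ y`
(`topologicalKrullDim_range_underlyingPt`). It is at most this because the degree drops strictly
under specialization (`trd_lt_of_specializes`), and at least this because `y` can be specialized so
that the degree at its image drops by exactly one (`exists_specializes_trd_map_eq`).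

Put N = dim X. The patterns of τ(A^G) on a finite Λ are the images of K-points under a morphism into
X^Λ. A residue field of X^Λ is generated by those of its coordinates (`trd_pow_le_sum`), so these
patterns have dimension at most |Λ|N, and enlarging Ω to Λ raises the dimension by at most |Λ \ Ω|N.
The first bound gives mdim ≤ N.

If mdim < N, the Følner condition yields Ω = F_i such that for Λ = Ω ∪ ΩM⁻¹ the patterns on Λ have
dimension below |Ω|N, which is at most dim A^Ω (`card_mul_trd_le_dimZ_univ`). Outside Λ the image of
a configuration in (A^Ω)_p depends only on p, so dim τ((A^Ω)_p) < dim A^Ω for every p, against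
(**)-pre-injectivity. -/

noncomputable section

namespace AlgCA

/-! ### Transcendence degrees of fields generated by images of algebras -/

section TranscendenceDegree

variable {K : Type*} [Field K]

/-- The hypothesis `hev`, which recurs below, says that `L` is the fraction field of the image of
`ev`. It models the residue field at a point of an affine chart. -/
theorem isAlgebraic_adjoin_of_forall_eq_div {C L : Type*} [CommRing C] [Algebra K C] [Field L]
    [Algebra K L] (ev : C →ₐ[K] L) (hev : ∀ x, ∃ a b, x = ev a / ev b) :
    Algebra.IsAlgebraic (Algebra.adjoin K (Set.range ev)) L := by
  constructor
  intro x
  obtain ⟨a, b, rfl⟩ := hev x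
  have h (c : C) : IsAlgebraic (Algebra.adjoin K (Set.range ev)) (ev c) :=
    isAlgebraic_algebraMap (⟨ev c, Algebra.subset_adjoin ⟨c, rfl⟩⟩ :
      Algebra.adjoin K (Set.range ev))
  rw [div_eq_mul_inv]
  exact (h a).mul (h b).inv

theorem trdeg_le_card_of_adjoin_eq_top {C L : Type*} [CommRing C] [Algebra K C] [Field L]
    [Algebra K L] (ev : C →ₐ[K] L) (hev : ∀ x, ∃ a b, x = ev a / ev b) (s : Finset C)
    (hs : Algebra.adjoin K (s : Set C) = ⊤) : Algebra.trdeg K L ≤ s.card := by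
  classical
  have h1 : Algebra.adjoin K (Set.range ev) = Algebra.adjoin K (ev '' (s : Set C)) := by
    rw [← AlgHom.map_adjoin, hs, Algebra.map_top, ← AlgHom.coe_range, Algebra.adjoin_eq]
  have h2 := isAlgebraic_adjoin_of_forall_eq_div ev hev
  rw [h1] at h2
  refine (Algebra.IsAlgebraic.trdeg_le_cardinalMk K (ev '' (s : Set C))).trans ?_
  rw [← Finset.coe_image]
  refine (Cardinal.mk_coe_finset (s := s.image ev)).le.trans ?_
  exact_mod_cast Finset.card_image_le

theorem exists_algebraicIndependent_comp {C L : Type*} [CommRing C] [Algebra K C] [Field L]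
    [Algebra K L] (ev : C →ₐ[K] L) (hev : ∀ x, ∃ a b, x = ev a / ev b) {n : ℕ}
    (hn : Algebra.trdeg K L = n) : ∃ t : Fin n → C, AlgebraicIndependent K (ev ∘ t) := by
  have := isAlgebraic_adjoin_of_forall_eq_div ev hev
  obtain ⟨s, hs, h⟩ := exists_isTranscendenceBasis_subset (R := K) (Set.range ev)
  have hc : Cardinal.mk s = n := h.cardinalMk_eq_trdeg.trans hn
  obtain ⟨e⟩ : Nonempty (Fin n ≃ s) := by
    rw [← Cardinal.lift_mk_eq', hc]; simp
  choose f hf using fun x : s => hs x.2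
  refine ⟨f ∘ e, ?_⟩
  have : ev ∘ f ∘ e = (fun x : s => (x : L)) ∘ e := by
    funext i; exact hf _
  rw [this]
  exact h.1.comp _ e.injective

/-- A transcendence basis of `L'` lifts to a family `t` in `C`. Any relation in `L` between `ev ∘ t`
and `ev b` reduces in `L'`, where `b` dies, to its constant term in `b`, which must vanish. So `ev
b` is transcendental over `ev ∘ t`, which gives `m + 1` independent elements. -/
theorem trdeg_lt_trdeg_of_ker_lt {C L L' : Type*} [CommRing C] [Algebra K C] [Field L]
    [Algebra K L] [Field L'] [Algebra K L'] (ev : C →ₐ[K] L) (ev' : C →ₐ[K] L')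
    (hev' : ∀ x, ∃ a b, x = ev' a / ev' b) (hle : ∀ c, ev c = 0 → ev' c = 0)
    {b : C} (hb : ev b ≠ 0) (hb' : ev' b = 0) {m n : ℕ} (hm : Algebra.trdeg K L' = m)
    (hn : Algebra.trdeg K L = n) : m < n := by
  obtain ⟨t, ht⟩ := exists_algebraicIndependent_comp ev' hev' hm
  have key (p : MvPolynomial (Fin m) K) (w : C)
      (h : MvPolynomial.aeval (ev ∘ t) p + ev b * ev w = 0) : p = 0 := by
    have e1 : MvPolynomial.aeval (ev ∘ t) p = ev (MvPolynomial.aeval t p) := by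
      rw [← AlgHom.comp_apply, MvPolynomial.comp_aeval]; rfl
    have e2 : MvPolynomial.aeval (ev' ∘ t) p = ev' (MvPolynomial.aeval t p) := by
      rw [← AlgHom.comp_apply, MvPolynomial.comp_aeval]; rfl
    rw [e1, ← map_mul, ← map_add] at h
    have h' := hle _ h
    rw [map_add, map_mul, hb', zero_mul, add_zero, ← e2] at h'
    exact ht.eq_zero_of_aeval_eq_zero _ h'
  have hind : AlgebraicIndependent K (ev ∘ t) := by
    rw [algebraicIndependent_iff]
    exact fun p hp => key p 0 (by simpa using hp)
  have htr : Transcendental (Algebra.adjoin K (Set.range (ev ∘ t))) (ev b) := by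
    intro halg
    -- As `ev b ≠ 0`, powers of it can be cancelled, so the relation may be taken with nonzero
    -- constant coefficient.
    obtain ⟨p, hp0, hp⟩ := halg.exists_nonzero_coeff_and_aeval_eq_zero
      (mem_nonZeroDivisors_of_ne_zero hb)
    apply hp0
    have hsub : Algebra.adjoin K (Set.range (ev ∘ t)) ≤ ev.range :=
      Algebra.adjoin_le (by rintro _ ⟨i, rfl⟩; exact ⟨t i, rfl⟩)
    obtain ⟨w, hw⟩ : Polynomial.aeval (ev b) p.divX ∈ ev.range := by
      rw [Polynomial.aeval_eq_sum_range]
      refine sum_mem fun i _ => ?_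
      rw [Algebra.smul_def]
      exact mul_mem (hsub (p.divX.coeff i).2) (pow_mem (AlgHom.mem_range_self ev b) i)
    rw [← Polynomial.divX_mul_X_add p] at hp
    simp only [map_add, map_mul, Polynomial.aeval_X, Polynomial.aeval_C] at hp
    have h0 := key (hind.aevalEquiv.symm (p.coeff 0)) w (by
      rw [← hind.algebraMap_aevalEquiv, AlgEquiv.apply_symm_apply]
      simp only [AlgHom.toRingHom_eq_coe, RingHom.coe_coe] at hw
      rw [hw, add_comm, mul_comm]; exact hp)
    simpa using h0
  have := ((hind.option_iff_transcendental (ev b)).mpr htr).lift_cardinalMk_le_trdeg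
  rw [hn] at this
  simp at this
  exact_mod_cast this

open scoped IntermediateField.algebraAdjoinAdjoin in
-- The images of transcendence bases of the `E i` form the set `S`. The relative algebraic closure
-- of `K(S)` contains every `g i (E i)`, so by `hg` it is all of `L`.
theorem trdeg_le_sum {ι : Type*} [Fintype ι] {L : Type*} [Field L] [Algebra K L]
    {E : ι → Type*} [∀ i, Field (E i)] [∀ i, Algebra K (E i)] (g : ∀ i, E i →ₐ[K] L)
    (hg : ∀ M : IntermediateField K L, (∀ i, (g i).fieldRange ≤ M) → M = ⊤) (d : ι → ℕ)
    (hd : ∀ i, Algebra.trdeg K (E i) = d i) : Algebra.trdeg K L ≤ ((∑ i, d i : ℕ) : Cardinal) := by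
  classical
  choose s hs using fun i => exists_isTranscendenceBasis K (E i)
  have hc (i) : Cardinal.mk (s i) = d i := (hs i).cardinalMk_eq_trdeg.trans (hd i)
  have hfin (i) : (s i).Finite := by
    rw [← Cardinal.lt_aleph0_iff_set_finite, hc]; exact Cardinal.natCast_lt_aleph0
  let S : Finset L := Finset.univ.biUnion fun i => (hfin i).toFinset.image (g i)
  have hS : S.card ≤ ∑ i, d i := by
    refine Finset.card_biUnion_le.trans (Finset.sum_le_sum fun i _ => ?_)
    refine Finset.card_image_le.trans ?_
    rw [← Nat.cast_le (α := Cardinal), ← hc i, ← Cardinal.mk_coe_finset]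
    exact (Cardinal.mk_congr (Equiv.subtypeEquivRight fun x => (hfin i).mem_toFinset)).le
  let M : IntermediateField K L :=
    (algebraicClosure (IntermediateField.adjoin K (S : Set L)) L).restrictScalars K
  have hM : M = ⊤ := by
    refine hg _ fun i => ?_
    rintro _ ⟨x, rfl⟩
    have hx := (hs i).isAlgebraic.1 x
    rw [Subtype.range_coe] at hx
    have hle : Algebra.adjoin K (s i) ≤
        ((IntermediateField.adjoin K (S : Set L)).toSubalgebra).comap (g i) := by
      refine Algebra.adjoin_le fun y hy => ?_
      refine IntermediateField.subset_adjoin K _ ?_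
      simp only [S, Finset.coe_biUnion, Set.mem_iUnion]
      exact ⟨i, by simp, by simpa using ⟨y, hy, rfl⟩⟩
    let f : Algebra.adjoin K (s i) →+* IntermediateField.adjoin K (S : Set L) :=
      ((g i : E i →+* L).comp (Algebra.adjoin K (s i)).val.toRingHom).codRestrict
        (IntermediateField.adjoin K (S : Set L)).toSubalgebra (fun y => hle y.2)
    have := hx.ringHom_of_comp_eq f (g i : E i →+* L)
      (fun a b hab => Subtype.ext ((g i).injective (congrArg Subtype.val hab))) (by ext; rfl)
    exact mem_algebraicClosure_iff.mpr this
  have halg : Algebra.IsAlgebraic (Algebra.adjoin K (S : Set L)) L := by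
    rw [IsFractionRing.comap_isAlgebraic_iff (A := Algebra.adjoin K (S : Set L))
      (K := IntermediateField.adjoin K (S : Set L))]
    refine ⟨fun x => mem_algebraicClosure_iff.mp ?_⟩
    exact (hM ▸ IntermediateField.mem_top : x ∈ M)
  refine (Algebra.IsAlgebraic.trdeg_le_cardinalMk K (S : Set L)).trans ?_
  exact (Cardinal.mk_coe_finset (s := S)).le.trans (by exact_mod_cast hS)

/-- In an algebraic closure of the rational functions in m × n variables, the i-th copy sends the
transcendence basis `t` to the i-th block of variables. It extends to `κ` because `κ` is algebraic
over `K[t]`. -/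
theorem exists_algebraicIndependent_copies {K : Type u} [Field K] {κ : Type u} [Field κ]
    [Algebra K κ] {n : ℕ} (hn : Algebra.trdeg K κ = n) (m : ℕ) :
    ∃ (L : Type u) (_ : Field L) (_ : Algebra K L) (g : Fin m → κ →ₐ[K] L) (t : Fin n → κ),
      AlgebraicIndependent K fun x : Fin m × Fin n => g x.1 (t x.2) := by
  obtain ⟨t, ht'⟩ : ∃ t : Fin n → κ, IsTranscendenceBasis K t := by
    obtain ⟨s, h⟩ := exists_isTranscendenceBasis K κ
    have hc : Cardinal.mk s = n := h.cardinalMk_eq_trdeg.trans hn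
    obtain ⟨e⟩ : Nonempty (Fin n ≃ s) := by
      rw [← Cardinal.lift_mk_eq', hc]; simp
    exact ⟨_, h.comp_equiv e⟩
  let P := MvPolynomial (Fin m × Fin n) K
  let L := AlgebraicClosure (FractionRing P)
  let x : Fin m × Fin n → L := fun i => algebraMap P L (MvPolynomial.X i)
  have hinj : Function.Injective (algebraMap P L) := by
    rw [IsScalarTower.algebraMap_eq P (FractionRing P) L]
    exact (algebraMap (FractionRing P) L).injective.comp (IsFractionRing.injective _ _)
  have hx : AlgebraicIndependent K x := by
    have := (MvPolynomial.algebraicIndependent_X (Fin m × Fin n) K).map'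
      (f := IsScalarTower.toAlgHom K P L) hinj
    exact this
  have hg (i : Fin m) : ∃ g : κ →ₐ[K] L, ∀ j, g (t j) = x (i, j) := by
    let A := Algebra.adjoin K (Set.range t)
    have hi : AlgebraicIndependent K fun j => x (i, j) := hx.comp _ (Prod.mk_right_injective i)
    let φ : A →ₐ[K] L := (MvPolynomial.aeval fun j => x (i, j)).comp
      ht'.1.aevalEquiv.symm.toAlgHom
    have hφ : Function.Injective φ := Function.Injective.comp (g := MvPolynomial.aeval _) hi ht'.1.aevalEquiv.symm.injective
    let _ : Algebra A L := φ.toRingHom.toAlgebra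
    have : IsScalarTower K A L := IsScalarTower.of_algebraMap_eq fun r => (φ.commutes r).symm
    have : FaithfulSMul A L := (faithfulSMul_iff_algebraMap_injective A L).mpr hφ
    have : Algebra.IsAlgebraic A κ := ht'.isAlgebraic
    let g : κ →ₐ[A] L := IsAlgClosed.lift
    refine ⟨g.restrictScalars K, fun j => ?_⟩
    have h1 : t j = algebraMap A κ (ht'.1.aevalEquiv (MvPolynomial.X j)) := by
      rw [ht'.1.algebraMap_aevalEquiv, MvPolynomial.aeval_X]
    rw [AlgHom.restrictScalars_apply, h1, g.commutes]
    change φ _ = _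
    simp [φ]
  choose g hg using hg
  refine ⟨L, inferInstance, inferInstance, g, t, ?_⟩
  simpa only [hg] using hx

theorem exists_algHom_isAlgebraic (F B : Type u) [Field F] [CommRing B] [Nontrivial B]
    [Algebra F B] [Algebra.FiniteType F B] :
    ∃ (L : Type u) (_ : Field L) (_ : Algebra F L) (_ : B →ₐ[F] L), Algebra.IsAlgebraic F L := by
  obtain ⟨I, hI⟩ := Ideal.exists_maximal B
  let _ : Field (B ⧸ I) := Ideal.Quotient.field I
  have := finite_of_finite_type_of_isJacobsonRing F (B ⧸ I)
  exact ⟨B ⧸ I, inferInstance, inferInstance, Ideal.Quotient.mkₐ F I, inferInstance⟩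

theorem trdeg_adjoin_eq {K L : Type u} [Field K] [Field L] [Algebra K L] {n : ℕ} {x : Fin n → L}
    (hx : AlgebraicIndependent K x) :
    Algebra.trdeg K (IntermediateField.adjoin K (Set.range x)) = n := by
  rw [← hx.aevalEquivField.trdeg_eq, ← trdeg_add_eq K (MvPolynomial (Fin n) K)]
  have : Algebra.IsAlgebraic (MvPolynomial (Fin n) K)
    (FractionRing (MvPolynomial (Fin n) K)) :=
    IsLocalization.isAlgebraic _ (nonZeroDivisors _)
  simp [trdeg_eq_zero]

theorem finiteType_adjoin_range {K B L : Type*} [Field K] [CommRing B] [Algebra K B]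
    [Algebra.FiniteType K B] [Field L] [Algebra K L] (F : IntermediateField K L)
    (ev : B →ₐ[K] L) : Algebra.FiniteType F (Algebra.adjoin F (Set.range ev)) := by
  classical
  obtain ⟨s, hs⟩ := (inferInstance : Algebra.FiniteType K B).out
  rw [← Subalgebra.fg_iff_finiteType]
  refine ⟨s.image ev, le_antisymm (Algebra.adjoin_mono (by simp)) (Algebra.adjoin_le ?_)⟩
  rintro _ ⟨b, rfl⟩
  have hb : b ∈ Algebra.adjoin K (s : Set B) := hs ▸ Algebra.mem_top
  have : Algebra.adjoin K (s : Set B) ≤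
      ((Algebra.adjoin F ((s.image ev : Finset L) : Set L)).restrictScalars K).comap ev := by
    refine Algebra.adjoin_le fun y hy => ?_
    change ev y ∈ Algebra.adjoin F ((s.image ev : Finset L) : Set L)
    exact Algebra.subset_adjoin (Finset.mem_coe.mpr (Finset.mem_image_of_mem ev hy))
  exact this hb

/-- Enlarge the image of `B` by the scalars `F = K(ev ∘ t)` and divide by a maximal ideal. By
Zariski's lemma the quotient is algebraic over `F`, while `F` embeds in it, so `t` stays independent
and nothing else does. -/
theorem exists_specialization_trdeg_eq {K : Type u} [Field K] {B L : Type u} [CommRing B]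
    [Algebra K B] [Algebra.FiniteType K B] [Field L] [Algebra K L] (ev : B →ₐ[K] L) {n : ℕ}
    {t : Fin n → B} (ht : AlgebraicIndependent K (ev ∘ t)) :
    ∃ (L' : Type u) (_ : Field L') (_ : Algebra K L') (ev' : B →ₐ[K] L'),
      (∀ b, ev b = 0 → ev' b = 0) ∧ AlgebraicIndependent K (ev' ∘ t) ∧
        Algebra.trdeg K L' = n := by
  let F : IntermediateField K L := IntermediateField.adjoin K (Set.range (ev ∘ t))
  let B' : Subalgebra F L := Algebra.adjoin F (Set.range ev)
  have hft : Algebra.FiniteType F B' := finiteType_adjoin_range F ev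
  obtain ⟨L', _, _, q, halg⟩ := exists_algHom_isAlgebraic F B'
  let _ : Algebra K L' := ((algebraMap F L').comp (algebraMap K F)).toAlgebra
  have : IsScalarTower K F L' := IsScalarTower.of_algebraMap_eq fun _ => rfl
  let ev0 : B →+* B' := (ev : B →+* L).codRestrict B' (fun b => Algebra.subset_adjoin ⟨b, rfl⟩)
  let ev' : B →ₐ[K] L' :=
    { (q : B' →+* L').comp ev0 with
      commutes' := fun r => by
        have h : ev0 (algebraMap K B r) = algebraMap F B' (algebraMap K F r) :=
          Subtype.ext (ev.commutes r)
        change q (ev0 (algebraMap K B r)) = _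
        rw [h, q.commutes]
        rfl }
  let x : Fin n → F := fun i => ⟨ev (t i), IntermediateField.subset_adjoin _ _ ⟨i, rfl⟩⟩
  have hx : AlgebraicIndependent K x :=
    AlgebraicIndependent.of_comp F.val ht
  have hcomp : ev' ∘ t = IsScalarTower.toAlgHom K F L' ∘ x := by
    funext i
    exact q.commutes (x i)
  refine ⟨L', inferInstance, inferInstance, ev', fun b hb => ?_, ?_, ?_⟩
  · have : ev0 b = 0 := Subtype.ext hb
    change q (ev0 b) = 0
    rw [this, map_zero]
  · rw [hcomp]
    exact hx.map' (algebraMap F L').injective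
  · have h0 : Algebra.trdeg F L' = 0 := trdeg_eq_zero_iff.mpr halg
    rw [← trdeg_add_eq K F (A := L'), h0, add_zero]
    exact trdeg_adjoin_eq ht

end TranscendenceDegree

/-! ### Residue fields of K-schemes and their behaviour under specialization -/

section ResidueFields

variable {K : Type u} [Field K]

instance residueAlgebra (X : Over (Spec (.of K))) (x : X.left) :
    Algebra K (X.left.residueField x) :=
  (Spec.preimage (X.left.fromSpecResidueField x ≫ X.hom)).hom.toAlgebra

theorem specMap_algebraMap_residue (X : Over (Spec (.of K))) (x : X.left) :
    Spec.map (CommRingCat.ofHom (algebraMap K (X.left.residueField x))) =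
      X.left.fromSpecResidueField x ≫ X.hom :=
  Spec.map_preimage _

/-- The `K`-algebra structure on the sections over an affine open subset of a `K`-scheme. -/
abbrev sectionAlgebra (X : Over (Spec (.of K))) {U : X.left.Opens} (hU : IsAffineOpen U) :
    Algebra K Γ(X.left, U) :=
  (Spec.preimage (hU.fromSpec ≫ X.hom)).hom.toAlgebra

theorem finiteType_sections (X : Over (Spec (.of K))) [LocallyOfFiniteType X.hom]
    {U : X.left.Opens} (hU : IsAffineOpen U) :
    @Algebra.FiniteType K Γ(X.left, U) _ _ (sectionAlgebra X hU) := by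
  have h : LocallyOfFiniteType (Spec.map (Spec.preimage (hU.fromSpec ≫ X.hom))) := by
    rw [Spec.map_preimage]; infer_instance
  exact (HasRingHomProperty.Spec_iff (P := @LocallyOfFiniteType)).mp h

theorem specMap_evaluation (X : Scheme.{u}) {U : X.Opens} (hU : IsAffineOpen U) {x : X}
    (hx : x ∈ U) : Spec.map (X.evaluation U x hx) ≫ hU.fromSpec = X.fromSpecResidueField x := by
  rw [Scheme.fromSpecResidueField, ← hU.fromSpecStalk_eq_fromSpecStalk hx,
    IsAffineOpen.fromSpecStalk, ← Scheme.germ_residue, Spec.map_comp, Category.assoc]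

theorem evaluation_comp_residueFieldMap {X Y : Scheme.{u}} (f : X ⟶ Y) {W : Y.Opens}
    (hW : IsAffineOpen W) {U : X.Opens} (hU : IsAffineOpen U) (h : U ≤ f ⁻¹ᵁ W) {x : X}
    (hx : x ∈ U) (hfx : f x ∈ W) : Y.evaluation W (f x) hfx ≫ f.residueFieldMap x =
      f.appLE W U h ≫ X.evaluation U x hx := by
  apply Spec.map_injective
  rw [← cancel_mono hW.fromSpec, Spec.map_comp, Spec.map_comp, Category.assoc, Category.assoc,
    specMap_evaluation, Scheme.Hom.SpecMap_residueFieldMap_fromSpecResidueField,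
    IsAffineOpen.SpecMap_appLE_fromSpec _ hW hU, ← Category.assoc, specMap_evaluation]

/-- The evaluation of sections at a point of an affine open subset, as a `K`-algebra map. -/
def evalHom (X : Over (Spec (.of K))) {U : X.left.Opens} (hU : IsAffineOpen U) {x : X.left}
    (hx : x ∈ U) :
    letI := sectionAlgebra X hU
    Γ(X.left, U) →ₐ[K] X.left.residueField x :=
  letI := sectionAlgebra X hU
  { (X.left.evaluation U x hx).hom with
    commutes' := fun r => by
      have h : Spec.preimage (hU.fromSpec ≫ X.hom) ≫ X.left.evaluation U x hx =
          Spec.preimage (X.left.fromSpecResidueField x ≫ X.hom) := by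
        apply Spec.map_injective
        rw [Spec.map_comp, Spec.map_preimage, Spec.map_preimage, ← Category.assoc,
          specMap_evaluation]
      exact congr($(h).hom r) }

theorem evalHom_eq_zero_iff (X : Over (Spec (.of K))) {U : X.left.Opens} (hU : IsAffineOpen U)
    {x : X.left} (hx : x ∈ U) (s : Γ(X.left, U)) :
    evalHom X hU hx s = 0 ↔ x ∉ X.left.basicOpen s :=
  X.left.evaluation_eq_zero_iff_notMem_basicOpen x hx s

theorem exists_eq_evalHom_div (X : Over (Spec (.of K))) {U : X.left.Opens} (hU : IsAffineOpen U)
    {x : X.left} (hx : x ∈ U) (r : X.left.residueField x) :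
    ∃ a b, r = evalHom X hU hx a / evalHom X hU hx b := by
  obtain ⟨z, rfl⟩ := X.left.residue_surjective x r
  let _ : Algebra Γ(X.left, U) (X.left.presheaf.stalk x) :=
    TopCat.Presheaf.algebra_section_stalk X.left.presheaf ⟨x, hx⟩
  have := hU.isLocalization_stalk ⟨x, hx⟩
  obtain ⟨⟨a, b⟩, h⟩ := IsLocalization.surj (hU.primeIdealOf ⟨x, hx⟩).asIdeal.primeCompl z
  have h' := congrArg (X.left.residue x) h
  rw [map_mul] at h'
  refine ⟨a, b, ?_⟩
  rw [eq_div_iff]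
  · exact h'
  · have hu := IsLocalization.map_units (X.left.presheaf.stalk x) b
    exact (hu.map (X.left.residue x).hom).ne_zero

theorem exists_residue_algHom (X : Over (Spec (.of K))) {L : Type u} [Field L] [Algebra K L]
    (g : Spec (.of L) ⟶ X.left)
    (hg : g ≫ X.hom = Spec.map (CommRingCat.ofHom (algebraMap K L))) :
    ∃ (x : X.left) (f : X.left.residueField x ⟶ .of L)
      (φ : X.left.residueField x →ₐ[K] L), (∀ r, φ r = f r) ∧
      Spec.map f ≫ X.left.fromSpecResidueField x = g := by
  obtain ⟨⟨x, f⟩, rfl⟩ := (Scheme.SpecToEquivOfField L X.left).symm.surjective g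
  rw [Scheme.SpecToEquivOfField_symm_apply] at hg ⊢
  refine ⟨x, f, { f.hom with commutes' := fun r => ?_ }, fun _ => rfl, rfl⟩
  have h : Spec.preimage (X.left.fromSpecResidueField x ≫ X.hom) ≫ f =
      CommRingCat.ofHom (algebraMap K L) := by
    apply Spec.map_injective
    rw [Spec.map_comp, Spec.map_preimage, ← hg, Category.assoc]
  exact congr($(h).hom r)

theorem exists_point_of_algHom (X : Over (Spec (.of K))) {U : X.left.Opens} (hU : IsAffineOpen U)
    {L : Type u} [Field L] [Algebra K L] :
    letI := sectionAlgebra X hU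
    ∀ ψ : Γ(X.left, U) →ₐ[K] L, ∃ (x : X.left) (hx : x ∈ U) (φ : X.left.residueField x →ₐ[K] L),
      ∀ s, φ (evalHom X hU hx s) = ψ s := by
  intro ψ
  let _ := sectionAlgebra X hU
  have hψ : Spec.preimage (hU.fromSpec ≫ X.hom) ≫ CommRingCat.ofHom ψ.toRingHom =
      CommRingCat.ofHom (algebraMap K L) := by
    ext r
    exact ψ.commutes r
  obtain ⟨x, f, φ, hφ, h⟩ := exists_residue_algHom X
    (Spec.map (CommRingCat.ofHom ψ.toRingHom) ≫ hU.fromSpec) (by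
      rw [← hψ, Spec.map_comp, Spec.map_preimage, Category.assoc])
  have hx : x ∈ U := by
    let p : Spec (.of L) := IsLocalRing.closedPoint L
    have h1 : (Spec.map f ≫ X.left.fromSpecResidueField x) p ∈ Set.range hU.fromSpec := by
      rw [h, Scheme.Hom.comp_apply]
      exact ⟨_, rfl⟩
    rw [hU.range_fromSpec, Scheme.Hom.comp_apply, Scheme.fromSpecResidueField_apply] at h1
    exact h1
  refine ⟨x, hx, φ, fun s => ?_⟩
  have h2 : X.left.evaluation U x hx ≫ f = CommRingCat.ofHom ψ.toRingHom := by
    apply Spec.map_injective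
    rw [← cancel_mono hU.fromSpec, ← h, Spec.map_comp, Category.assoc, specMap_evaluation]
  rw [hφ]
  exact congr($(h2).hom s)

/-- The map of residue fields induced by a morphism of `K`-schemes. -/
def residueMap {Y Z : Over (Spec (.of K))} (φ : Y ⟶ Z) (y : Y.left) :
    Z.left.residueField (φ.left y) →ₐ[K] Y.left.residueField y :=
  { (φ.left.residueFieldMap y).hom with
    commutes' := fun r => by
      have h : Spec.preimage (Z.left.fromSpecResidueField (φ.left y) ≫ Z.hom) ≫
          φ.left.residueFieldMap y = Spec.preimage (Y.left.fromSpecResidueField y ≫ Y.hom) := by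
        apply Spec.map_injective
        rw [Spec.map_comp, Spec.map_preimage, Spec.map_preimage, ← Category.assoc,
          Scheme.Hom.SpecMap_residueFieldMap_fromSpecResidueField, Category.assoc, Over.w]
      exact congr($(h).hom r) }

/-- The transcendence degree over `K` of the residue field of a point of a `K`-scheme. -/
def trd (X : Over (Spec (.of K))) (x : X.left) : ℕ :=
  Cardinal.toNat (Algebra.trdeg K (X.left.residueField x))

theorem trdeg_le_of_mem (X : Over (Spec (.of K))) [LocallyOfFiniteType X.hom]
    {U : X.left.Opens} (hU : IsAffineOpen U) :
    ∃ N : ℕ, ∀ x ∈ U, Algebra.trdeg K (X.left.residueField x) ≤ N := by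
  let _ := sectionAlgebra X hU
  obtain ⟨s, hs⟩ := (finiteType_sections X hU).out
  exact ⟨s.card, fun x hx =>
    trdeg_le_card_of_adjoin_eq_top (evalHom X hU hx) (exists_eq_evalHom_div X hU hx) s hs⟩

theorem trdeg_residueField (X : Over (Spec (.of K))) [LocallyOfFiniteType X.hom] (x : X.left) :
    Algebra.trdeg K (X.left.residueField x) = trd X x := by
  obtain ⟨U, hU, hx, -⟩ := exists_isAffineOpen_mem_and_subset (TopologicalSpace.Opens.mem_top x)
  obtain ⟨N, hN⟩ := trdeg_le_of_mem X hU
  exact (Cardinal.cast_toNat_of_lt_aleph0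
    ((hN x hx).trans_lt Cardinal.natCast_lt_aleph0)).symm

theorem exists_forall_trd_le (X : Over (Spec (.of K))) [LocallyOfFiniteType X.hom]
    [QuasiCompact X.hom] : ∃ N : ℕ, ∀ x, trd X x ≤ N := by
  have : CompactSpace X.left := by
    have := (quasiCompact_iff_compactSpace X.hom).mp inferInstance
    exact this
  choose U hU hx _ using fun x : X.left =>
    exists_isAffineOpen_mem_and_subset (TopologicalSpace.Opens.mem_top x)
  choose N hN using fun x => trdeg_le_of_mem X (hU x)
  obtain ⟨t, ht⟩ := isCompact_univ.elim_finite_subcover (fun x => (U x : Set X.left))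
    (fun x => (U x).isOpen) (fun x _ => Set.mem_iUnion.mpr ⟨x, hx x⟩)
  refine ⟨t.sup N, fun x => ?_⟩
  obtain ⟨y, hy, hxy⟩ := Set.mem_iUnion₂.mp (ht (Set.mem_univ x))
  have h := hN y x hxy
  rw [trdeg_residueField] at h
  exact (Nat.cast_le.mp h).trans (Finset.le_sup hy)

theorem trd_map_le {Y Z : Over (Spec (.of K))} [LocallyOfFiniteType Y.hom]
    [LocallyOfFiniteType Z.hom] (φ : Y ⟶ Z) (y : Y.left) : trd Z (φ.left y) ≤ trd Y y := by
  have := trdeg_le_of_injective (residueMap φ y) (residueMap φ y).injective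
  rw [trdeg_residueField, trdeg_residueField] at this
  exact_mod_cast this

theorem trd_lt_of_specializes (X : Over (Spec (.of K))) [LocallyOfFiniteType X.hom]
    {x x' : X.left} (h : x ⤳ x') (hne : x ≠ x') : trd X x' < trd X x := by
  obtain ⟨U, hU, hx', -⟩ := exists_isAffineOpen_mem_and_subset (TopologicalSpace.Opens.mem_top x')
  have hx : x ∈ U := h.mem_open U.isOpen hx'
  have hnot : ¬ x' ⤳ x := fun h' => hne (h.antisymm h').eq
  rw [specializes_iff_forall_open] at hnot
  push Not at hnot
  obtain ⟨O, hO, hxO, hx'O⟩ := hnot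
  -- The section `b` vanishes at `x'` but not at `x`, so the kernel of evaluation grows strictly.
  obtain ⟨b, hb, hxb⟩ := hU.exists_basicOpen_le (V := ⟨O, hO⟩) ⟨x, hxO⟩ hx
  let _ := sectionAlgebra X hU
  refine trdeg_lt_trdeg_of_ker_lt (evalHom X hU hx) (evalHom X hU hx')
    (exists_eq_evalHom_div X hU hx') (fun c hc => ?_) (b := b) ?_ ?_
    (trdeg_residueField X x') (trdeg_residueField X x)
  · rw [evalHom_eq_zero_iff] at hc ⊢
    exact fun h' => hc (h.mem_open (X.left.basicOpen c).isOpen h')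
  · rw [ne_eq, evalHom_eq_zero_iff, not_not]
    exact hxb
  · rw [evalHom_eq_zero_iff]
    exact fun h' => hx'O (hb h')

/-- Drop one element from a transcendence basis at `φ y`, and specialize on a chart of `Y` to a
field algebraic over the remaining n. That field contains the residue field of `y'`, which bounds
the degree at the image above by n; the n surviving elements bound it below. -/
theorem exists_specializes_trd_map_eq {Y Z : Over (Spec (.of K))} [LocallyOfFiniteType Y.hom]
    [LocallyOfFiniteType Z.hom] (φ : Y ⟶ Z) {y : Y.left} {n : ℕ}
    (hn : trd Z (φ.left y) = n + 1) : ∃ y', y ⤳ y' ∧ trd Z (φ.left y') = n := by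
  obtain ⟨W, hW, hyW, -⟩ :=
    exists_isAffineOpen_mem_and_subset (TopologicalSpace.Opens.mem_top (φ.left y))
  obtain ⟨U, hU, hyU, hUW⟩ :=
    exists_isAffineOpen_mem_and_subset (U := φ.left ⁻¹ᵁ W) (x := y) hyW
  let _ := sectionAlgebra Y hU
  let _ := sectionAlgebra Z hW
  have := finiteType_sections Y hU
  have hz := trdeg_residueField Z (φ.left y)
  rw [hn] at hz
  obtain ⟨t, ht⟩ := exists_algebraicIndependent_comp (evalHom Z hW hyW)
    (exists_eq_evalHom_div Z hW hyW) hz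
  let r : Γ(Z.left, W) → Γ(Y.left, U) := φ.left.appLE W U hUW
  have hr {x : Y.left} (hx : x ∈ U) (s : Γ(Z.left, W)) :
      residueMap φ x (evalHom Z hW (hUW hx) s) = evalHom Y hU hx (r s) := by
    have h := evaluation_comp_residueFieldMap φ.left hW hU hUW hx (hUW hx)
    exact congr($(h).hom s)
  have h1 : AlgebraicIndependent K (evalHom Y hU hyU ∘ r ∘ t ∘ Fin.castSucc) := by
    have h2 := (ht.map' (residueMap φ y).injective).comp _ (Fin.castSucc_injective n)
    convert! h2 using 1
    funext i
    exact (hr hyU _).symm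
  obtain ⟨L, _, _, ψ, hker, hind, hL⟩ := exists_specialization_trdeg_eq _ h1
  obtain ⟨y', hy', e, he⟩ := exists_point_of_algHom Y hU ψ
  refine ⟨y', ?_, le_antisymm ?_ ?_⟩
  · rw [specializes_iff_forall_open]
    intro O hO hyO
    obtain ⟨f, hf, hyf⟩ := hU.exists_basicOpen_le (V := ⟨O, hO⟩) ⟨y', hyO⟩ hy'
    refine hf ?_
    by_contra hy0
    have h3 := hker f ((evalHom_eq_zero_iff Y hU hyU f).mpr hy0)
    rw [← he, map_eq_zero_iff e e.injective, evalHom_eq_zero_iff] at h3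
    exact h3 hyf
  · refine (trd_map_le φ y').trans ?_
    have h3 := trdeg_le_of_injective e e.injective
    rw [hL, trdeg_residueField] at h3
    exact_mod_cast h3
  · have h3 : AlgebraicIndependent K (evalHom Z hW (hUW hy') ∘ t ∘ Fin.castSucc) := by
      refine AlgebraicIndependent.of_comp (e.comp (residueMap φ y')) ?_
      convert! hind using 1
      funext i
      simp only [Function.comp_apply, AlgHom.comp_apply]
      rw [hr hy', he]
    have h4 := h3.lift_cardinalMk_le_trdeg
    rw [trdeg_residueField] at h4
    simpa using h4

end ResidueFields

/-! ### Finite type and quasi-compactness of powers of X -/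

section FiniteProducts

variable {C : Type*} [Category* C]

theorem isClosedUnderFiniteProducts_overObj (P : MorphismProperty C) [P.IsMultiplicative]
    [P.IsStableUnderBaseChange] (B : C) [HasFiniteProducts (Over B)] :
    (P.overObj (X := B)).IsClosedUnderFiniteProducts := by
  have : (P.overObj (X := B)).IsClosedUnderBinaryProducts := by
    refine ⟨?_⟩
    rintro X ⟨p⟩
    let Y := p.diag.obj ⟨WalkingPair.left⟩
    let Z := p.diag.obj ⟨WalkingPair.right⟩
    let e : X ≅ Y ⨯ Z := IsLimit.conePointsIsoOfNatIso p.isLimit (limit.isLimit (pair Y Z))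
      (diagramIsoPair p.diag)
    refine (P.overObj (X := B)).prop_of_iso e.symm ?_
    have h := Over.isPullback_of_binaryFan_isLimit _ (prodIsProd Y Z)
    have h1 : P (prod.fst (X := Y) (Y := Z)).left :=
      P.of_isPullback h.flip (p.prop_diag_obj ⟨WalkingPair.right⟩)
    change P (Y ⨯ Z).hom
    rw [← Over.w (prod.fst (X := Y) (Y := Z))]
    exact P.comp_mem _ _ h1 (p.prop_diag_obj ⟨WalkingPair.left⟩)
  exact ObjectProperty.IsClosedUnderFiniteProducts.mk'

end FiniteProducts

section PowInstances

variable {K : Type u} [Field K] (X : Over (Spec (.of K))) (E : Type v) [Finite E]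

instance locallyOfFiniteType_pow [LocallyOfFiniteType X.hom] :
    LocallyOfFiniteType (Pow X E).hom := by
  have := isClosedUnderFiniteProducts_overObj @LocallyOfFiniteType (Spec (.of K))
  exact (MorphismProperty.overObj @LocallyOfFiniteType).prop_product (fun _ : E => ‹_›)

instance quasiCompact_pow [QuasiCompact X.hom] : QuasiCompact (Pow X E).hom := by
  have := isClosedUnderFiniteProducts_overObj @QuasiCompact (Spec (.of K))
  exact (MorphismProperty.overObj @QuasiCompact).prop_product (fun _ : E => ‹_›)

end PowInstances

/-! ### Irreducible sets and generic points -/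

section Topology

variable {α : Type*} [TopologicalSpace α]

theorem isIrreducible_of_image_val {S : Set α} {T : Set S}
    (h : IsIrreducible (Subtype.val '' T)) : IsIrreducible T := by
  refine ⟨h.1.of_image, ?_⟩
  rintro _ _ ⟨u, hu, rfl⟩ ⟨v, hv, rfl⟩ ⟨a, haT, hau⟩ ⟨b, hbT, hbv⟩
  obtain ⟨_, ⟨c, hcT, rfl⟩, hc⟩ := h.2 u v hu hv ⟨a, ⟨a, haT, rfl⟩, hau⟩ ⟨b, ⟨b, hbT, rfl⟩, hbv⟩
  exact ⟨c, hcT, hc⟩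

/-- The preimage of the closure of `z` has finitely many irreducible pieces. Since `z` lies in the
closure of a finite union of their images, it lies in the closure of one image. The generic point of
that piece maps to a point that specializes to `z` and is a specialization of it. -/
theorem exists_eq_of_mem_closure {β : Type*} [TopologicalSpace β] [TopologicalSpace.NoetherianSpace α]
    [QuasiSober α] [T0Space β] {f : α → β} (hf : Continuous f) {S : Set β}
    (hS : S ⊆ Set.range f) {z : β} (hz : z ∈ closure (S ∩ closure {z})) : ∃ y, f y = z := by
  obtain ⟨𝒮, hfin, hcl, hirr, hU⟩ :=
    TopologicalSpace.NoetherianSpace.exists_finite_set_isClosed_irreducible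
      (isClosed_closure.preimage hf (t := closure {z}))
  have hsub : S ∩ closure {z} ⊆ ⋃ t ∈ 𝒮, closure (f '' t) := by
    rintro _ ⟨hx, hxz⟩
    obtain ⟨y, rfl⟩ := hS hx
    have hy : y ∈ ⋃₀ 𝒮 := hU ▸ hxz
    obtain ⟨t, ht, hyt⟩ := hy
    exact Set.mem_iUnion₂.mpr ⟨t, ht, subset_closure ⟨y, hyt, rfl⟩⟩
  have hz' := closure_minimal hsub (hfin.isClosed_biUnion fun _ _ => isClosed_closure) hz
  obtain ⟨t, ht, hzt⟩ := Set.mem_iUnion₂.mp hz'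
  have hgen := (hirr t ht).isGenericPoint_genericPoint (hcl t ht)
  refine ⟨(hirr t ht).genericPoint, ?_⟩
  have h1 : f (hirr t ht).genericPoint ⤳ z := (hgen.image hf).specializes hzt
  have h2 : z ⤳ f (hirr t ht).genericPoint := by
    rw [specializes_iff_mem_closure]
    have : (hirr t ht).genericPoint ∈ f ⁻¹' closure {z} := by
      rw [hU]; exact ⟨t, ht, hgen.mem⟩
    exact this
  exact (h1.antisymm h2).eq

end Topology

/-! ### Krull dimension of sets of K-points via transcendence degree -/

section Dimension

variable {K : Type u} [Field K]

/-- A chain of irreducible closed subsets of `S` gives, by taking closures in `Z`, a chain of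
generic points with strictly increasing degree. Only points `z` in which `S` is dense in the closure
of `z` arise, and the hypothesis is restricted to these. -/
theorem topologicalKrullDim_le_of_forall_trd_le (Z : Over (Spec (.of K)))
    [LocallyOfFiniteType Z.hom] (S : Set Z.left) (N : ℕ)
    (h : ∀ z, z ∈ closure (S ∩ closure {z}) → trd Z z ≤ N) : topologicalKrullDim S ≤ N := by
  let m : TopologicalSpace.IrreducibleCloseds S → TopologicalSpace.IrreducibleCloseds Z.left :=
    TopologicalSpace.IrreducibleCloseds.map Subtype.val continuous_subtype_val
  have hm : StrictMono m :=
    TopologicalSpace.IrreducibleCloseds.map_strictMono_of_isInducing IsInducing.subtypeVal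
  let η : TopologicalSpace.IrreducibleCloseds Z.left → Z.left := fun T => T.isIrreducible.genericPoint
  have hη (T : TopologicalSpace.IrreducibleCloseds Z.left) : closure {η T} = (T : Set Z.left) :=
    T.isIrreducible.closure_genericPoint T.isClosed
  have hmono : StrictMono fun T => trd Z (η (m T)) := by
    intro T T' hT
    refine trd_lt_of_specializes Z ?_ fun he => (hm hT).ne ?_
    · rw [specializes_iff_closure_subset, hη, hη]
      exact (hm hT).le
    · apply SetLike.coe_injective
      rw [← hη, ← hη, he]
  refine iSup_le fun p => ?_
  have h1 := (p.map _ hmono).head_add_length_le_nat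
  have h2 : trd Z (η (m p.last)) ≤ N := by
    refine h _ ?_
    rw [hη]
    have h3 : closure (Subtype.val '' (p.last : Set S)) = (m p.last : Set Z.left) := rfl
    have h4 : η (m p.last) ∈ (m p.last : Set Z.left) := by
      rw [← hη]; exact subset_closure rfl
    rw [← h3] at h4
    refine closure_mono ?_ h4
    rintro _ ⟨x, hx, rfl⟩
    exact ⟨x.2, subset_closure ⟨x, hx, rfl⟩⟩
  have h5 : p.length ≤ N := by
    rw [LTSeries.last_map] at h1
    exact (le_trans (Nat.le_add_left _ _) h1).trans h2
  exact_mod_cast h5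

theorem underlyingPt_comp {Y Z : Over (Spec (.of K))} (y : Pts Y) (φ : Y ⟶ Z) :
    underlyingPt (y ≫ φ) = φ.left (underlyingPt y) := by
  simp [underlyingPt]
  rfl

variable [IsAlgClosed K]

theorem range_underlyingPt (Y : Over (Spec (.of K))) [LocallyOfFiniteType Y.hom] :
    Set.range (underlyingPt : Pts Y → Y.left) = closedPoints Y.left := by
  ext x
  constructor
  · rintro ⟨y, rfl⟩
    exact (pointEquivClosedPoint Y.hom ⟨y.left, Over.w y⟩).2
  · intro hx
    refine ⟨Over.homMk (pointOfClosedPoint Y.hom x hx) (pointOfClosedPoint_comp _ _ _), ?_⟩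
    exact pointOfClosedPoint_apply Y.hom x hx _

/-- K-points are dense in the closure of `y`, as `Y` is Jacobson, so `S` is dense in the closure of
`φ y`. Distinct closures therefore have distinct traces on `S`, and repeated specialization lowering
the degree by one gives a chain of the required length. -/
theorem trd_map_le_topologicalKrullDim {Y Z : Over (Spec (.of K))} [LocallyOfFiniteType Y.hom]
    [LocallyOfFiniteType Z.hom] (φ : Y ⟶ Z) (S : Set Z.left)
    (hS : ∀ y : Pts Y, underlyingPt (y ≫ φ) ∈ S) (y : Y.left) :
    (trd Z (φ.left y) : WithBot ℕ∞) ≤ topologicalKrullDim S := by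
  have : JacobsonSpace Y.left := LocallyOfFiniteType.jacobsonSpace Y.hom
  have hdense (y : Y.left) : closure (S ∩ closure {φ.left y}) = closure {φ.left y} := by
    refine (closure_minimal Set.inter_subset_right isClosed_closure).antisymm ?_
    refine closure_minimal (Set.singleton_subset_iff.mpr ?_) isClosed_closure
    have h1 : y ∈ closure (closure {y} ∩ closedPoints Y.left) := by
      rw [JacobsonSpace.closure_inter_closedPoints isClosed_closure]
      exact subset_closure rfl
    have h2 := image_closure_subset_closure_image φ.left.continuous (Set.mem_image_of_mem φ.left h1)
    refine closure_mono ?_ h2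
    rintro _ ⟨x, ⟨hx, hxc⟩, rfl⟩
    rw [← range_underlyingPt] at hxc
    obtain ⟨p, rfl⟩ := hxc
    refine ⟨underlyingPt_comp p φ ▸ hS p, ?_⟩
    rw [← specializes_iff_mem_closure] at hx ⊢
    exact hx.map φ.left.continuous
  have himg (y : Y.left) : Subtype.val '' ((↑) ⁻¹' closure {φ.left y} : Set S) =
      S ∩ closure {φ.left y} := Subtype.image_preimage_coe _ _
  let I (y : Y.left) : TopologicalSpace.IrreducibleCloseds S :=
    { carrier := (↑) ⁻¹' closure {φ.left y}
      isIrreducible' := by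
        apply isIrreducible_of_image_val
        rw [himg, ← isIrreducible_iff_closure, hdense]
        exact isIrreducible_singleton.closure
      isClosed' := isClosed_closure.preimage continuous_subtype_val }
  have hI (y : Y.left) : (I y : Set S) = (↑) ⁻¹' closure {φ.left y} := rfl
  have key (n : ℕ) : ∀ y, trd Z (φ.left y) = n → (n : ℕ∞) ≤ Order.height (I y) := by
    induction n with
    | zero => simp
    | succ n ih =>
      intro y hy
      obtain ⟨y', hyy', hy'⟩ := exists_specializes_trd_map_eq φ hy
      have hlt : I y' < I y := by
        refine lt_of_le_of_ne ?_ fun he => ?_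
        · refine SetLike.coe_subset_coe.mp ?_
          rw [hI, hI]
          exact Set.preimage_mono
            (specializes_iff_closure_subset.mp (hyy'.map φ.left.continuous))
        · have h1 : closure {φ.left y'} = closure {φ.left y} := by
            rw [← hdense, ← himg, ← hI, he, hI, himg, hdense]
          have h2 : φ.left y' = φ.left y := by
            refine (Specializes.antisymm ?_ ?_).eq <;>
              rw [specializes_iff_closure_subset, h1]
          rw [h2, hy] at hy'
          omega
      have h1 := Order.height_add_one_le hlt
      push_cast
      exact (add_le_add_left (ih y' hy') 1).trans h1
  exact (WithBot.coe_le_coe.mpr (key _ y rfl)).trans (Order.height_le_krullDim (I y))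

end Dimension

/-! ### Points of powers of X and the residue fields of their coordinates -/

section Products

variable {K : Type u} [Field K] (X : Over (Spec (.of K)))

/-- The spectrum of a field extension of `K`, as a `K`-scheme. -/
abbrev specOver (K : Type u) [Field K] (L : Type u) [Field L] [Algebra K L] :
    Over (Spec (.of K)) :=
  Over.mk (Spec.map (CommRingCat.ofHom (algebraMap K L)))

/-- The canonical morphism `Spec κ(x) ⟶ X` of `K`-schemes. -/
def fromResidue (x : X.left) : specOver K (X.left.residueField x) ⟶ X :=
  Over.homMk (X.left.fromSpecResidueField x) (specMap_algebraMap_residue X x).symm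

/-- The morphism of spectra induced by a map of field extensions of `K`. -/
def specOverMap {L L' : Type u} [Field L] [Algebra K L] [Field L'] [Algebra K L']
    (g : L →ₐ[K] L') : specOver K L' ⟶ specOver K L :=
  Over.homMk (Spec.map (CommRingCat.ofHom g.toRingHom)) (by
    simp only [Over.mk_hom, Over.mk_left, ← Spec.map_comp]
    congr 1
    ext r
    exact g.commutes r)

theorem specOverMap_comp {L L' L'' : Type u} [Field L] [Algebra K L] [Field L'] [Algebra K L']
    [Field L''] [Algebra K L''] (g : L →ₐ[K] L') (h : L' →ₐ[K] L'') :
    specOverMap (h.comp g) = specOverMap h ≫ specOverMap g := by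
  ext1
  exact Spec.map_comp (CommRingCat.ofHom g.toRingHom) (CommRingCat.ofHom h.toRingHom)

theorem specOverMap_id (L : Type u) [Field L] [Algebra K L] :
    specOverMap (AlgHom.id K L) = 𝟙 _ := by
  ext1
  exact Spec.map_id (.of L)

theorem fromResidue_comp {Y Z : Over (Spec (.of K))} (φ : Y ⟶ Z) (y : Y.left) :
    fromResidue Y y ≫ φ = specOverMap (residueMap φ y) ≫ fromResidue Z (φ.left y) := by
  ext1
  exact (Scheme.Hom.SpecMap_residueFieldMap_fromSpecResidueField φ.left y).symm

theorem exists_eq_specOverMap_comp {L : Type u} [Field L] [Algebra K L] (g : specOver K L ⟶ X) :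
    ∃ (x : X.left) (φ : X.left.residueField x →ₐ[K] L), g = specOverMap φ ≫ fromResidue X x := by
  obtain ⟨x, f, φ, hφ, h⟩ := exists_residue_algHom X g.left (Over.w g)
  refine ⟨x, φ, ?_⟩
  ext1
  have hf : f = CommRingCat.ofHom φ.toRingHom := by
    ext r; exact (hφ r).symm
  rw [← h, hf]
  rfl

theorem exists_eq_of_specOverMap_comp_eq {L : Type u} [Field L] [Algebra K L] {x y : X.left}
    (φ : X.left.residueField x →ₐ[K] L) (ψ : X.left.residueField y →ₐ[K] L)
    (h : specOverMap φ ≫ fromResidue X x = specOverMap ψ ≫ fromResidue X y) :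
    ∃ e : x = y, ∀ r, φ r = ψ ((X.left.residueFieldCongr e).hom r) := by
  have h1 : (⟨x, CommRingCat.ofHom φ.toRingHom⟩ :
      Σ x : X.left, X.left.residueField x ⟶ .of L) = ⟨y, CommRingCat.ofHom ψ.toRingHom⟩ :=
    (Scheme.SpecToEquivOfField L X.left).symm.injective congr(($h).left)
  rw [Scheme.SpecToEquivOfField_eq_iff] at h1
  obtain ⟨e, h2⟩ := h1
  exact ⟨e, fun r => congr($(h2).hom r)⟩

variable {E : Type v} [Finite E]

/-- If all coordinates of `z` are defined over `M`, then so is the canonical morphism from the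
spectrum of the residue field. The identity of that field then factors through `M`. -/
theorem eq_top_of_forall_coordinate (z : (Pow X E).left)
    (M : IntermediateField K ((Pow X E).left.residueField z))
    (h : ∀ e, ∃ g : specOver K M ⟶ X,
      specOverMap M.val ≫ g = fromResidue (Pow X E) z ≫ Pi.π (fun _ : E => X) e) : M = ⊤ := by
  choose g hg using h
  have h1 : specOverMap M.val ≫ Pi.lift g = fromResidue (Pow X E) z := by
    refine Pi.hom_ext _ _ fun e => ?_
    rw [Category.assoc, Pi.lift_π, hg]
  obtain ⟨x, φ, hφ⟩ := exists_eq_specOverMap_comp (Pow X E) (Pi.lift g)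
  have h2 : specOverMap (M.val.comp φ) ≫ fromResidue (Pow X E) x =
      specOverMap (AlgHom.id K _) ≫ fromResidue (Pow X E) z := by
    rw [specOverMap_comp, Category.assoc, ← hφ, h1, specOverMap_id,
      Category.id_comp]
  obtain ⟨rfl, h3⟩ := exists_eq_of_specOverMap_comp_eq (Pow X E) _ _ h2
  rw [eq_top_iff]
  intro r _
  have h4 := h3 r
  rw [Scheme.residueFieldCongr_refl] at h4
  have h5 : ((φ r : M) : (Pow X E).left.residueField x) = r := h4
  rw [← h5]
  exact (φ r).2

theorem trd_pow_le_sum [LocallyOfFiniteType X.hom] {ι : Type*} [Fintype ι]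
    {Y : ι → Over (Spec (.of K))} [∀ i, LocallyOfFiniteType (Y i).hom] (φ : ∀ i, Pow X E ⟶ Y i)
    (h : ∀ e, ∃ (i : ι) (ψ : Y i ⟶ X), Pi.π (fun _ : E => X) e = φ i ≫ ψ) (z : (Pow X E).left) :
    trd (Pow X E) z ≤ ∑ i, trd (Y i) ((φ i).left z) := by
  have h1 := trdeg_le_sum (fun i => residueMap (φ i) z) (fun M hM => ?_)
    (fun i => trd (Y i) ((φ i).left z)) (fun i => trdeg_residueField (Y i) ((φ i).left z))
  · rw [trdeg_residueField] at h1
    exact_mod_cast h1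
  · refine eq_top_of_forall_coordinate X z M fun e => ?_
    obtain ⟨i, ψ, hψ⟩ := h e
    let g : (Y i).left.residueField ((φ i).left z) →ₐ[K] M :=
      (residueMap (φ i) z).codRestrict M.toSubalgebra fun r => hM i ⟨r, rfl⟩
    refine ⟨specOverMap g ≫ fromResidue (Y i) _ ≫ ψ, ?_⟩
    have h2 : M.val.comp g = residueMap (φ i) z := rfl
    rw [hψ, ← Category.assoc, ← specOverMap_comp, h2, ← Category.assoc, ← Category.assoc,
      fromResidue_comp]

/-- Independent copies of the residue field of `x` in one field `L` define an `L`-point of the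
power. The residue field of its image `z` contains all the independent elements. -/
theorem exists_card_mul_trd_le [LocallyOfFiniteType X.hom] (x : X.left) :
    ∃ z : (Pow X E).left, Nat.card E * trd X x ≤ trd (Pow X E) z := by
  obtain ⟨L, _, _, g, t, hind⟩ :=
    exists_algebraicIndependent_copies (trdeg_residueField X x) (Nat.card E)
  let c : E ≃ Fin (Nat.card E) := Finite.equivFin E
  obtain ⟨z, φ, hφ⟩ := exists_eq_specOverMap_comp (Pow X E)
    (Pi.lift fun e : E => specOverMap (g (c e)) ≫ fromResidue X x)
  refine ⟨z, ?_⟩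
  have hr (p : Fin (Nat.card E) × Fin (trd X x)) :
      ∃ r : (Pow X E).left.residueField z, φ r = g p.1 (t p.2) := by
    have h1 : specOverMap (g p.1) ≫ fromResidue X x =
        specOverMap (φ.comp (residueMap (Pi.π (fun _ : E => X) (c.symm p.1)) z)) ≫
          fromResidue X _ := by
      rw [specOverMap_comp, Category.assoc, ← fromResidue_comp, ← Category.assoc, ← hφ, Pi.lift_π,
        Equiv.apply_symm_apply]
    obtain ⟨e, h2⟩ := exists_eq_of_specOverMap_comp_eq X _ _ h1
    exact ⟨_, (h2 (t p.2)).symm⟩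
  choose r hr using hr
  have h1 : AlgebraicIndependent K r := by
    refine AlgebraicIndependent.of_comp φ ?_
    convert! hind using 1
    exact funext hr
  have h2 := h1.lift_cardinalMk_le_trdeg
  rw [trdeg_residueField] at h2
  simp only [Cardinal.mk_prod, Cardinal.mk_fin, Cardinal.lift_natCast, Cardinal.lift_mul] at h2
  exact_mod_cast h2

end Products

/-! ### Dimension of images of morphisms and of full powers -/

section Dimension

variable {K : Type u} [Field K]

theorem noetherianSpace_left {Y : Over (Spec (.of K))} [LocallyOfFiniteType Y.hom]
    [QuasiCompact Y.hom] : TopologicalSpace.NoetherianSpace Y.left := by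
  have : CompactSpace Y.left := QuasiCompact.compactSpace_of_compactSpace Y.hom
  have : IsLocallyNoetherian Y.left := LocallyOfFiniteType.isLocallyNoetherian Y.hom
  have : IsNoetherian Y.left := {}
  infer_instance

theorem exists_trd_map_max {Y Z : Over (Spec (.of K))} [LocallyOfFiniteType Y.hom]
    [QuasiCompact Y.hom] [LocallyOfFiniteType Z.hom] [Nonempty Y.left] (φ : Y ⟶ Z) :
    ∃ y₀ : Y.left, ∀ y, trd Z (φ.left y) ≤ trd Z (φ.left y₀) := by
  obtain ⟨N, hN⟩ := exists_forall_trd_le Y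
  have hfin : (Set.range fun y => trd Z (φ.left y)).Finite :=
    (Set.finite_Iic N).subset (by rintro _ ⟨y, rfl⟩; exact (trd_map_le φ y).trans (hN y))
  obtain ⟨_, ⟨y₀, rfl⟩, h⟩ := Set.exists_max_image _ id hfin (Set.range_nonempty _)
  exact ⟨y₀, fun y => h _ ⟨y, rfl⟩⟩

theorem dimZ_mono (X : Over (Spec (.of K))) {E : Type v} [Finite E] {D D' : Set (E → Pts X)}
    (h : D ⊆ D') : dimZ X D ≤ dimZ X D' := by
  have : zariskiSet X D ⊆ zariskiSet X D' := Set.image_mono h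
  exact (Topology.IsEmbedding.inclusion this).isInducing.topologicalKrullDim_le

theorem powPt_comp_π (X : Over (Spec (.of K))) {E : Type v} [Finite E] (y : Pts (Pow X E)) :
    powPt X (fun e => y ≫ Pi.π (fun _ : E => X) e) = y :=
  Pi.hom_ext _ _ fun e => by simp [powPt]

variable [IsAlgClosed K]

theorem topologicalKrullDim_range_underlyingPt {Y Z : Over (Spec (.of K))}
    [LocallyOfFiniteType Y.hom] [QuasiCompact Y.hom] [LocallyOfFiniteType Z.hom] (φ : Y ⟶ Z)
    {y₀ : Y.left} (h : ∀ y, trd Z (φ.left y) ≤ trd Z (φ.left y₀)) :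
    topologicalKrullDim (Set.range fun y : Pts Y => underlyingPt (y ≫ φ)) =
      (trd Z (φ.left y₀) : WithBot ℕ∞) := by
  have := noetherianSpace_left (Y := Y)
  refine le_antisymm (topologicalKrullDim_le_of_forall_trd_le Z _ _ fun z hz => ?_)
    (trd_map_le_topologicalKrullDim φ _ (fun y => Set.mem_range_self y) y₀)
  -- The generic points that matter lie in the image of `φ`, so the maximum over `Y` bounds them.
  obtain ⟨y, rfl⟩ := exists_eq_of_mem_closure φ.left.continuous (by
    rintro _ ⟨y, rfl⟩
    exact ⟨underlyingPt y, (underlyingPt_comp y φ).symm⟩) hz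
  exact h y

theorem topologicalKrullDim_left_eq (X : Over (Spec (.of K))) [LocallyOfFiniteType X.hom]
    {x₀ : X.left} (h : ∀ x, trd X x ≤ trd X x₀) :
    topologicalKrullDim X.left = (trd X x₀ : WithBot ℕ∞) := by
  refine le_antisymm ?_ ?_
  · refine ((Homeomorph.Set.univ X.left).symm.isInducing.topologicalKrullDim_le).trans ?_
    exact topologicalKrullDim_le_of_forall_trd_le X _ _ fun z _ => h z
  · refine (trd_map_le_topologicalKrullDim (𝟙 X) Set.univ (fun _ => trivial) x₀).trans ?_
    exact topologicalKrullDim_subspace_le _ _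

theorem card_mul_trd_le_dimZ_univ (X : Over (Spec (.of K))) [LocallyOfFiniteType X.hom]
    (E : Type v) [Finite E] (x : X.left) :
    ((Nat.card E * trd X x : ℕ) : WithBot ℕ∞) ≤ dimZ X (Set.univ : Set (E → Pts X)) := by
  obtain ⟨z, hz⟩ := exists_card_mul_trd_le X (E := E) x
  refine le_trans (by exact_mod_cast hz) (trd_map_le_topologicalKrullDim (𝟙 (Pow X E))
    (zariskiSet X Set.univ) (fun y => ?_) z)
  refine ⟨fun e => y ≫ Pi.π (fun _ : E => X) e, trivial, ?_⟩
  simp only [powPt_comp_π, Category.comp_id]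

end Dimension

/-! ### Patterns of the image of an algebraic cellular automaton -/

section CellularAutomata

variable {K : Type u} [Field K] (X : Over (Spec (.of K))) {G : Type v} [Group G]
  {τ : (G → Pts X) → (G → Pts X)} {M : Finset G} {f : Pow X M ⟶ X}

/-- The morphism `X^Δ ⟶ X^Λ` that induces the map from patterns on a neighbourhood `Δ ⊇ Λ M` to
their images on `Λ` under the cellular automaton with memory set `M` and local map `f`. -/
def patternHom (f : Pow X M ⟶ X) (Λ Δ : Finset G) (h : ∀ g ∈ Λ, ∀ m ∈ M, g * m ∈ Δ) :
    Pow X Δ ⟶ Pow X Λ :=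
  Pi.lift fun l : Λ => Pi.lift (fun m : M =>
    Pi.π (fun _ : Δ => X) ⟨l.1 * m.1, h l.1 l.2 m.1 m.2⟩) ≫ f

theorem powPt_patternHom (hf : IsLocalDefiningMap τ M (inducedMap X f)) {Λ Δ : Finset G}
    (h : ∀ g ∈ Λ, ∀ m ∈ M, g * m ∈ Δ) (c : G → Pts X) :
    powPt X (res Δ c) ≫ patternHom X f Λ Δ h = powPt X (res Λ (τ c)) := by
  refine Pi.hom_ext _ _ fun l => ?_
  rw [Category.assoc, patternHom, Pi.lift_π, powPt, powPt, Pi.lift_π, ← Category.assoc]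
  simp only [res]
  rw [hf, inducedMap]
  congr 1
  refine Pi.hom_ext _ _ fun m => ?_
  simp [powPt, res, shift]

theorem zariskiSet_image_range (hf : IsLocalDefiningMap τ M (inducedMap X f)) [Nonempty (Pts X)]
    {Λ Δ : Finset G} (h : ∀ g ∈ Λ, ∀ m ∈ M, g * m ∈ Δ) :
    zariskiSet X (res Λ '' Set.range τ) =
      Set.range fun y : Pts (Pow X Δ) => underlyingPt (y ≫ patternHom X f Λ Δ h) := by
  ext z
  constructor
  · rintro ⟨_, ⟨_, ⟨c, rfl⟩, rfl⟩, rfl⟩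
    exact ⟨powPt X (res Δ c), congrArg underlyingPt (powPt_patternHom X hf h c)⟩
  · rintro ⟨y, rfl⟩
    let c : G → Pts X := glue Δ (fun e => y ≫ Pi.π (fun _ : Δ => X) e) fun _ => Classical.arbitrary _
    refine ⟨_, ⟨_, ⟨c, rfl⟩, rfl⟩, ?_⟩
    simp only
    rw [← powPt_patternHom X hf h c, res_glue, powPt_comp_π]

theorem image_cyl_eq_cyl (hf : IsLocalDefiningMap τ M (inducedMap X f)) [Nonempty (Pts X)]
    {Ω Λ : Finset G} (h : ∀ g, ∀ m ∈ M, g * m ∈ Ω → g ∈ Λ) (p : {g : G // g ∉ Ω} → Pts X) :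
    ∃ q, τ '' cyl Ω Set.univ p = cyl Λ (res Λ '' (τ '' cyl Ω Set.univ p)) q := by
  let c₀ : G → Pts X := glue Ω (fun _ => Classical.arbitrary _) p
  have hout {c : G → Pts X} (hc : c ∈ cyl Ω Set.univ p) {g : G} (hg : g ∉ Λ) :
      τ c g = τ c₀ g := by
    rw [hf, hf]
    congr 1
    funext m
    -- The neighbourhood gM of a cell outside Λ misses Ω, so the value there depends on `p` alone.
    have hm : g * m.1 ∉ Ω := fun hm => hg (h g m.1 m.2 hm)
    have h₀ : c₀ ∈ cyl Ω Set.univ p := glue_mem_cyl (Set.mem_univ _) p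
    simp only [res, shift, inv_inv]
    exact (hc.2 ⟨_, hm⟩).trans (h₀.2 ⟨_, hm⟩).symm
  refine ⟨fun g => τ c₀ g, Set.Subset.antisymm ?_ ?_⟩
  · rintro _ ⟨c, hc, rfl⟩
    exact ⟨⟨_, ⟨c, hc, rfl⟩, rfl⟩, fun g => hout hc g.2⟩
  · rintro c' ⟨⟨_, ⟨c, hc, rfl⟩, h1⟩, h2⟩
    refine ⟨c, hc, funext fun g => ?_⟩
    by_cases hg : g ∈ Λ
    · exact congrFun h1 ⟨g, hg⟩
    · rw [hout hc hg, h2 ⟨g, hg⟩]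

theorem exists_dimZ_image_range [IsAlgClosed K] [LocallyOfFiniteType X.hom] [QuasiCompact X.hom]
    [DecidableEq G] (hf : IsLocalDefiningMap τ M (inducedMap X f)) [Nonempty (Pts X)]
    {N : ℕ} (hN : ∀ x, trd X x ≤ N) (Λ : Finset G) :
    ∃ r : ℕ, dimZ X (res Λ '' Set.range τ) = r ∧ r ≤ Λ.card * N ∧
      ∀ Ω : Finset G, Ω ⊆ Λ → ∃ s : ℕ, dimZ X (res Ω '' Set.range τ) = s ∧
        r ≤ s + (Λ \ Ω).card * N := by
  -- One neighbourhood serves both Λ and Ω, so that the pattern morphism of Ω factors through that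
  -- of Λ.
  let Δ : Finset G := Finset.image₂ (· * ·) Λ M
  have hΔ : ∀ g ∈ Λ, ∀ m ∈ M, g * m ∈ Δ := fun g hg m hm => Finset.mem_image₂_of_mem hg hm
  have : Nonempty (Pow X Δ).left := ⟨underlyingPt (powPt X fun _ => Classical.arbitrary _)⟩
  obtain ⟨y₀, hy₀⟩ := exists_trd_map_max (patternHom X f Λ Δ hΔ)
  refine ⟨trd (Pow X Λ) ((patternHom X f Λ Δ hΔ).left y₀), ?_, ?_, fun Ω hΩ => ?_⟩
  · rw [dimZ, zariskiSet_image_range X hf hΔ]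
    exact topologicalKrullDim_range_underlyingPt _ hy₀
  · refine (trd_pow_le_sum X (Pi.π fun _ : Λ => X) (fun e => ⟨e, 𝟙 X, (Category.comp_id _).symm⟩)
      _).trans ?_
    refine (Finset.sum_le_card_nsmul _ _ N fun _ _ => hN _).trans ?_
    simp
  · have hΩΔ : ∀ g ∈ Ω, ∀ m ∈ M, g * m ∈ Δ := fun g hg => hΔ g (hΩ hg)
    let π : Pow X Λ ⟶ Pow X Ω := Pi.lift fun e : Ω => Pi.π (fun _ : Λ => X) ⟨e.1, hΩ e.2⟩
    have hπe (e : Ω) : π ≫ Pi.π (fun _ : Ω => X) e = Pi.π (fun _ : Λ => X) ⟨e.1, hΩ e.2⟩ :=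
      Pi.lift_π _ e
    have hπ : patternHom X f Λ Δ hΔ ≫ π = patternHom X f Ω Δ hΩΔ := by
      refine Pi.hom_ext _ _ fun e => ?_
      simp [π, patternHom]
    obtain ⟨y₁, hy₁⟩ := exists_trd_map_max (patternHom X f Ω Δ hΩΔ)
    refine ⟨trd (Pow X Ω) ((patternHom X f Ω Δ hΩΔ).left y₁), ?_, ?_⟩
    · rw [dimZ, zariskiSet_image_range X hf hΩΔ]
      exact topologicalKrullDim_range_underlyingPt _ hy₁
    · let Y : Option (Λ \ Ω : Finset G) → Over (Spec (.of K)) := fun i => i.elim (Pow X Ω) fun _ => X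
      have hY : ∀ i, LocallyOfFiniteType (Y i).hom := by
        intro i
        cases i
        · exact locallyOfFiniteType_pow X Ω
        · exact ‹LocallyOfFiniteType X.hom›
      let φ : ∀ i, Pow X Λ ⟶ Y i
        | none => π
        | some j => Pi.π (fun _ : Λ => X) ⟨j.1, (Finset.mem_sdiff.mp j.2).1⟩
      refine (trd_pow_le_sum X φ (fun e => ?_) _).trans ?_
      · by_cases he : e.1 ∈ Ω
        · exact ⟨none, Pi.π (fun _ : Ω => X) ⟨e.1, he⟩, (hπe ⟨e.1, he⟩).symm⟩
        · exact ⟨some ⟨e.1, Finset.mem_sdiff.mpr ⟨e.2, he⟩⟩, 𝟙 X, (Category.comp_id _).symm⟩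
      · rw [Fintype.sum_option]
        refine add_le_add ?_ ?_
        · have h1 := hy₁ y₀
          rw [← hπ] at h1
          rw [← hπ]
          exact h1
        · refine (Finset.sum_le_card_nsmul _ _ N fun _ _ => hN _).trans ?_
          simp

end CellularAutomata

/-! ### Følner boundaries and the bound on mean dimension -/

section MeanDimension

theorem IsFolnerNet.tendsto_card_boundary {G : Type v} [Group G] [DecidableEq G] {I : Type w}
    [Preorder I] {F : I → Finset G} (hF : IsFolnerNet F) (M : Finset G) :
    Tendsto (fun i => (((F i ∪ Finset.image₂ (fun g m => g * m⁻¹) (F i) M) \ F i).card : ℝ) /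
      (F i).card) atTop (𝓝 0) := by
  have h1 : Tendsto (fun i => ∑ m ∈ M,
      (((F i : Set G) \ ((fun h => h * m) '' (F i : Set G))).ncard : ℝ) / ((F i).card : ℝ))
      atTop (𝓝 0) := by
    simpa using tendsto_finsetSum M fun m _ => hF.tendsto m
  refine squeeze_zero (fun i => by positivity) (fun i => ?_) h1
  rw [← Finset.sum_div]
  gcongr
  -- If a m⁻¹ lies outside F_i with a in F_i, then a lies in F_i \ F_i m, whose relative size tends
  -- to zero.
  have h2 : (F i ∪ Finset.image₂ (fun g m => g * m⁻¹) (F i) M) \ F i ⊆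
      M.biUnion fun m => (F i \ (F i).image (· * m)).image (· * m⁻¹) := by
    intro g hg
    obtain ⟨hg1, hg2⟩ := Finset.mem_sdiff.mp hg
    obtain ⟨a, ha, m, hm, rfl⟩ := Finset.mem_image₂.mp ((Finset.mem_union.mp hg1).resolve_left hg2)
    refine Finset.mem_biUnion.mpr ⟨m, hm, Finset.mem_image_of_mem _ (Finset.mem_sdiff.mpr
      ⟨ha, fun h => hg2 ?_⟩)⟩
    obtain ⟨b, hb, rfl⟩ := Finset.mem_image.mp h
    simpa using hb
  have h3 := (Finset.card_le_card h2).trans Finset.card_biUnion_le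
  calc _ ≤ ((∑ m ∈ M, ((F i \ (F i).image (· * m)).image (· * m⁻¹)).card : ℕ) : ℝ) := by
        exact_mod_cast h3
    _ ≤ _ := by
      push_cast
      refine Finset.sum_le_sum fun m _ => ?_
      rw [← Finset.coe_image, ← Finset.coe_sdiff, Set.ncard_coe_finset]
      exact_mod_cast Finset.card_image_le

theorem dimToEReal_natCast (n : ℕ) : dimToEReal (n : WithBot ℕ∞) = ((n : ℝ) : EReal) := by
  change (((n : ℕ∞) : ENNReal) : EReal) = _
  rw [ENat.toENNReal_coe]
  rfl

theorem not_isStarStarPreInjective_of_boundary {K : Type u} [Field K] [IsAlgClosed K]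
    (X : Over (Spec (.of K))) [LocallyOfFiniteType X.hom] [QuasiCompact X.hom] {G : Type v}
    [Group G] [DecidableEq G] {τ : (G → Pts X) → (G → Pts X)} {M : Finset G} {f : Pow X M ⟶ X}
    (hf : IsLocalDefiningMap τ M (inducedMap X f)) [Nonempty (Pts X)] {x₀ : X.left}
    (hx₀ : ∀ x, trd X x ≤ trd X x₀) {Ω Λ : Finset G} (hΩΛ : Ω ⊆ Λ)
    (hΛ : ∀ g, ∀ m ∈ M, g * m ∈ Ω → g ∈ Λ) {s : ℕ} (hs : dimZ X (res Ω '' Set.range τ) = s)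
    (h : s + (Λ \ Ω).card * trd X x₀ < Ω.card * trd X x₀) : ¬ IsStarStarPreInjective X τ := by
  refine not_not.mpr ⟨Ω, fun p => ?_⟩
  obtain ⟨q, hq⟩ := image_cyl_eq_cyl X hf hΛ p
  obtain ⟨r, hr, -, hrs⟩ := exists_dimZ_image_range X hf hx₀ Λ
  obtain ⟨s', hs', hle⟩ := hrs Ω hΩΛ
  have hss : s = s' := by
    rw [hs] at hs'
    exact_mod_cast hs'
  subst hss
  rw [hq, finSuppDim_cyl]
  calc _ ≤ dimZ X (res Λ '' Set.range τ) :=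
        dimZ_mono X (Set.image_mono (Set.image_subset_range _ _))
    _ = (r : WithBot ℕ∞) := hr
    _ < ((Nat.card Ω * trd X x₀ : ℕ) : WithBot ℕ∞) := by
      have h1 : r < Nat.card Ω * trd X x₀ := by
        rw [Nat.card_eq_fintype_card, Fintype.card_coe]
        exact hle.trans_lt h
      exact_mod_cast h1
    _ ≤ _ := card_mul_trd_le_dimZ_univ X Ω x₀

end MeanDimension

end AlgCA

end

theorem mainTheorem8 {K : Type u} [Field K] [IsAlgClosed K]
    (X : Over (Spec (.of K))) [LocallyOfFiniteType X.hom] [QuasiCompact X.hom]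
    {G : Type v} [Group G]
    {I : Type w} [Preorder I] [IsDirectedOrder I] [Nonempty I]
    (F : I → Finset G) (hF : AlgCA.IsFolnerNet F)
    (τ : (G → AlgCA.Pts X) → (G → AlgCA.Pts X)) (hτ : AlgCA.IsAlgebraicCA X τ)
    (hpre : AlgCA.IsStarStarPreInjective X τ) :
    AlgCA.mdim X F (Set.range τ) = AlgCA.dimToEReal (topologicalKrullDim X.left) := by
  classical
  obtain ⟨M, f, hf⟩ := hτ
  -- If A is empty, there is no `p` on the complement of Ω = ∅, which contains 1, so the condition
  -- excluded by pre-injectivity holds vacuously.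
  have : Nonempty (AlgCA.Pts X) := by
    by_contra h
    exact hpre ⟨∅, fun p => (h ⟨p ⟨1, by simp⟩⟩).elim⟩
  have : Nonempty X.left := ⟨AlgCA.underlyingPt (Classical.arbitrary (AlgCA.Pts X))⟩
  obtain ⟨x₀, hx₀⟩ := AlgCA.exists_trd_map_max (𝟙 X)
  replace hx₀ : ∀ x, AlgCA.trd X x ≤ AlgCA.trd X x₀ := hx₀
  choose s hs using fun i => AlgCA.exists_dimZ_image_range X hf hx₀ (F i)
  have hcard (i) : (0 : ℝ) < (F i).card := by exact_mod_cast (hF.nonempty i).card_pos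
  have hterm (i) : AlgCA.dimToEReal (AlgCA.dimZ X (AlgCA.res (F i) '' Set.range τ)) /
      (((F i).card : ℝ) : EReal) = ((s i / (F i).card : ℝ) : EReal) := by
    rw [(hs i).1, AlgCA.dimToEReal_natCast, ← EReal.coe_div]
  rw [AlgCA.topologicalKrullDim_left_eq X hx₀, AlgCA.dimToEReal_natCast, AlgCA.mdim]
  simp only [hterm]
  refine le_antisymm ?_ ?_
  · refine limsup_le_of_le (by isBoundedDefault) (Eventually.of_forall fun i => ?_)
    rw [EReal.coe_le_coe_iff, div_le_iff₀ (hcard i), mul_comm]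
    exact_mod_cast (hs i).2.1
  · by_contra! hlt
    -- With mdim < q < N, an index is chosen where the patterns have dimension below q|F_i| and the
    -- boundary contributes less than (N - q)|F_i|; the two add up to less than N|F_i|.
    obtain ⟨q, hq1, hq2⟩ := EReal.lt_iff_exists_real_btwn.mp hlt
    rw [EReal.coe_lt_coe_iff] at hq2
    have h1 := eventually_lt_of_limsup_lt hq1
    have h2 := (hF.tendsto_card_boundary M).mul_const (AlgCA.trd X x₀ : ℝ)
    rw [zero_mul] at h2
    obtain ⟨i, hi1, hi2⟩ := (h1.and (h2.eventually_lt_const (sub_pos.mpr hq2))).exists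
    rw [EReal.coe_lt_coe_iff, div_lt_iff₀ (hcard i)] at hi1
    rw [div_mul_eq_mul_div, div_lt_iff₀ (hcard i)] at hi2
    refine AlgCA.not_isStarStarPreInjective_of_boundary X hf hx₀
      (Λ := F i ∪ Finset.image₂ (fun g m => g * m⁻¹) (F i) M) Finset.subset_union_left
      (fun g m hm hg => Finset.mem_union_right _ (Finset.mem_image₂.mpr ⟨g * m, hg, m, hm, ?_⟩))
      (hs i).1 ?_ hpre
    · simp
    · have h3 := add_lt_add hi1 hi2
      rw [← add_mul, add_sub_cancel, mul_comm (AlgCA.trd X x₀ : ℝ)] at h3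
      exact_mod_cast h3
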